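/- Let $Y$ be a nonempty set and let $X$ be a nonempty subset of a Hausdorff real topological vector space $E$ which is invariant under infinite convex combinations, i.e. for every sequence $(x_n)$ in $X$ and all real numbers $\lambda_n\ge 0$ with $\sum_{n}\lambda_n=1$, the series $\sum_n\lambda_n x_n$ converges in $E$ and its sum belongs to $X$ (in particular, $X$ is convex). Let $H,L:X\times Y\to\mathbb R$ be two functions such that (i) $H$ is bounded on $X\times Y$; for every $y\in Y$ the function $H(\cdot,y):X\to\mathbb R$ is convex and satisfies $H(\lambda x,y)=\lambda H(x,y)$ whenever $\lambda>0$, $x\in X$ and $\lambda x\in X$; and for every $x\in X$ there exists $y_x\in Y$ with $H(x,y_x)=\sup_{y\in Y}H(x,y)$; (ii) the closed linear span $\overline{\mathrm{span}}\{H(\cdot,y):y\in Y\}$ is a separable subspace of $\ell^\infty(X)$, the Banach space of bounded real functions on $X$ with the supremum norm; (iii) $L$ is supinf-concave on $Y$, i.e. $$\sup_{y\in Y}\inf_{x\in X}L(x,y)=\sup_{\substack{n\ge 1,\ y_1,\dots,y_n\in Y\\ \lambda_1,\dots,\lambda_n\ge 0,\ \sum_i\lambda_i=1}}\ \inf_{x\in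 X}\ \sum_{i=1}^n\lambda_i L(x,y_i);$$ (iv) $H(x,y)\le L(x,y)$ for all $x\in X$, $y\in Y$. Then $$\inf_{x\in X}\sup_{y\in Y}H(x,y)\ \le\ \sup_{y\in Y}\inf_{x\in X}L(x,y),$$ where all suprema and infima are taken in $[-\infty,+\infty]$. -/

import Mathlib

open Filter Topology
open scoped ENNReal

/-- `X` is invariant under infinite convex combinations: for every sequence `x` in `X` and all
coefficients `c n ≥ 0` with `∑ c n = 1`, the series `∑ c n • x n` converges (in the sense of
partial sums) in the ambient space and its sum belongs to `X`. -/
def InvariantUnderInfiniteConvexCombinations {E : Type*} [AddCommGroup E] [Module ℝ E]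
    [TopologicalSpace E] (X : Set E) : Prop :=
  ∀ x : ℕ → E, (∀ n, x n ∈ X) → ∀ c : ℕ → ℝ, (∀ n, 0 ≤ c n) → HasSum c 1 →
    ∃ s ∈ X, Tendsto (fun N => ∑ n ∈ Finset.range N, c n • x n) atTop (𝓝 s)

/-- `f : X × Y → ℝ` is supinf-concave on `Y`: `sup_y inf_x f (x, y)` is the supremum, over all
`n ≥ 1`, `y₁, …, yₙ ∈ Y` and `(l₁, …, lₙ)` in the simplex, of `inf_x ∑ lᵢ f (x, yᵢ)`.
Suprema and infima are taken in the extended reals. -/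
def SupinfConcave {X Y : Type*} (f : X → Y → ℝ) : Prop :=
  (⨆ y : Y, ⨅ x : X, ((f x y : ℝ) : EReal)) =
    ⨆ (n : ℕ) (_ : 1 ≤ n) (y : Fin n → Y) (l : Fin n → ℝ) (_ : l ∈ stdSimplex ℝ (Fin n)),
      ⨅ x : X, ((∑ i, l i * f x (y i) : ℝ) : EReal)

/-- The closed linear span, in the Banach space `ℓ^∞(X)` of bounded real functions on `X` with the
supremum norm, of the functions `f (·, y)`, `y ∈ Y` (for `f` bounded in `x`, each `f (·, y)` is
exactly one element of `ℓ^∞(X)`). -/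
noncomputable def closedSpanSections {X Y : Type*} (f : X → Y → ℝ) :
    Submodule ℝ (lp (fun _ : X => ℝ) ∞) :=
  (Submodule.span ℝ {φ : lp (fun _ : X => ℝ) ∞ | ∃ y : Y, ∀ x : X, φ x = f x y}).topologicalClosure

/-! If the inequality fails, take reals `α < β` strictly between the two sides. Supinf-concavity and
`H ≤ L` make every finite convex combination of sections of `H` drop below `α` somewhere. By
Hahn–Banach the sets `C_k = {x | H x (u i) ≤ α for i < k}` are then nonempty, where `u` indexes a
uniformly dense sequence of sections.

Simons' argument chooses `z_k ∈ C_k` greedily, almost minimizing `S = sup_y H` along dyadic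
averages, and sets `v = ∑ 2^{-k-1} z_k`. With `a_k` the normalized partial sum and `t_k ∈ C_k` the
tail average, `v = (1 - 2^{-k}) a_k + 2^{-k} t_k`, so `v` is itself a competitor at each step. If
`y₀` attains `S v`, summing the greedy estimates and using convexity gives `S v ≤ H t_k y₀ + δ`.
Density bounds the right side by `α + 2δ` for a suitable `k`. -/

theorem InvariantUnderInfiniteConvexCombinations.exists_combo {E : Type*} [AddCommGroup E]
    [Module ℝ E] [TopologicalSpace E] [T2Space E] {X : Set E}
    (hX : InvariantUnderInfiniteConvexCombinations X) (x₁ x₂ : X) (a b : ℝ)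
    (ha : 0 ≤ a) (hb : 0 ≤ b) (hab : a + b = 1) :
    ∃ x₃ : X, (x₃ : E) = a • (x₁ : E) + b • (x₂ : E) := by
  let c : ℕ → ℝ := fun n => if n = 0 then a else if n = 1 then b else 0
  let x : ℕ → E := fun n => if n = 0 then x₁ else x₂
  have hc2 : ∀ n ∉ Finset.range 2, c n = 0 := by
    intro n hn
    have : 2 ≤ n := by simpa [Nat.succ_le_iff] using hn
    simp [c, show n ≠ 0 by omega, show n ≠ 1 by omega]
  have hc : HasSum c 1 := by
    have h : HasSum c (∑ n ∈ Finset.range 2, c n) := hasSum_sum_of_ne_finset_zero hc2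
    simpa [Finset.sum_range_succ, c, hab] using h
  obtain ⟨s, hs, hlim⟩ := hX x (fun n => by dsimp only [x]; split_ifs <;> simp) c
    (fun n => by dsimp only [c]; split_ifs <;> simp [ha, hb]) hc
  refine ⟨⟨s, hs⟩, tendsto_nhds_unique hlim ?_⟩
  refine tendsto_const_nhds.congr' ?_
  filter_upwards [eventually_ge_atTop 2] with N hN
  rw [← Finset.sum_subset (Finset.range_subset_range.2 hN)
    (fun n _ hn => by rw [hc2 n hn, zero_smul])]
  simp [Finset.sum_range_succ, c, x]

/-- Dyadic averages of the tails of a sequence satisfy the one-step recursion. -/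
theorem InvariantUnderInfiniteConvexCombinations.exists_dyadic_tails {E : Type*} [AddCommGroup E]
    [Module ℝ E] [TopologicalSpace E] [IsTopologicalAddGroup E] [ContinuousSMul ℝ E] [T2Space E]
    {X : Set E} (hX : InvariantUnderInfiniteConvexCombinations X) (z : ℕ → X) :
    ∃ t : ℕ → X, ∀ k, (t k : E) = (1 / 2 : ℝ) • (z k : E) + (1 / 2 : ℝ) • (t (k + 1) : E) := by
  have hc : HasSum (fun n : ℕ => (1 / 2 : ℝ) ^ (n + 1)) 1 := by
    have h := hasSum_geometric_two.mul_left (1 / 2 : ℝ)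
    simpa [pow_succ'] using h
  have key : ∀ k, ∃ s : X, Tendsto
      (fun N => ∑ n ∈ Finset.range N, (1 / 2 : ℝ) ^ (n + 1) • (z (k + n) : E)) atTop (𝓝 s) := by
    intro k
    obtain ⟨s, hs, h⟩ := hX (fun n => z (k + n)) (fun n => (z _).2)
      (fun n => (1 / 2 : ℝ) ^ (n + 1)) (fun n => by positivity) hc
    exact ⟨⟨s, hs⟩, h⟩
  choose t ht using key
  refine ⟨t, fun k => tendsto_nhds_unique ((tendsto_add_atTop_iff_nat 1).2 (ht k)) ?_⟩
  refine (((ht (k + 1)).const_smul (1 / 2 : ℝ)).const_add ((1 / 2 : ℝ) • (z k : E))).congr ?_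
  intro N
  rw [Finset.sum_range_succ', Finset.smul_sum, add_comm]
  congr 1
  · refine Finset.sum_congr rfl fun n _ => ?_
    rw [smul_smul, ← pow_succ', show k + 1 + n = k + (n + 1) by ring]
  · simp

/-- A finite minimax theorem: if no convex combination of the convex functions `h i` is bounded
below by `α`, then the functions `h i` are simultaneously below `α` at some point. -/
theorem exists_forall_lt_of_forall_stdSimplex {E : Type*} [AddCommGroup E] [Module ℝ E]
    {X : Set E} (hXne : X.Nonempty)
    (hXc : ∀ (x₁ x₂ : X) (a b : ℝ), 0 ≤ a → 0 ≤ b → a + b = 1 →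
      ∃ x₃ : X, (x₃ : E) = a • (x₁ : E) + b • (x₂ : E))
    {n : ℕ} (h : Fin n → X → ℝ)
    (hconv : ∀ (i : Fin n) (x₁ x₂ x₃ : X) (a b : ℝ), 0 ≤ a → 0 ≤ b → a + b = 1 →
      (x₃ : E) = a • (x₁ : E) + b • (x₂ : E) → h i x₃ ≤ a * h i x₁ + b * h i x₂)
    (α : ℝ) (hα : ∀ l ∈ stdSimplex ℝ (Fin n), ∃ x : X, ∑ i, l i * h i x < α) :
    ∃ x : X, ∀ i, h i x < α := by
  by_contra! hcon
  let A : Set (Fin n → ℝ) := {w | ∃ x : X, ∀ i, h i x < w i}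
  have hAconv : Convex ℝ A := by
    rintro w₁ ⟨x₁, h₁⟩ w₂ ⟨x₂, h₂⟩ a b ha hb hab
    obtain ⟨x₃, h₃⟩ := hXc x₁ x₂ a b ha hb hab
    refine ⟨x₃, fun i => (hconv i x₁ x₂ x₃ a b ha hb hab h₃).trans_lt ?_⟩
    simp only [Pi.add_apply, Pi.smul_apply, smul_eq_mul]
    rcases ha.eq_or_lt with rfl | ha'
    · have : b = 1 := by linarith
      subst this
      simpa using h₂ i
    · have := mul_lt_mul_of_pos_left (h₁ i) ha'
      have := mul_le_mul_of_nonneg_left (h₂ i).le hb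
      linarith
  have hAopen : IsOpen A := by
    have : A = ⋃ x : X, ⋂ i, {w | h i x < w i} := by
      ext w
      simp [A]
    rw [this]
    exact isOpen_iUnion fun x => isOpen_iInter_of_finite fun i =>
      isOpen_lt continuous_const (continuous_apply i)
  have hα' : (fun _ => α) ∉ A := fun ⟨x, hx⟩ => by
    obtain ⟨i, hi⟩ := hcon x
    exact absurd (hx i) (not_lt.2 hi)
  obtain ⟨f, hf⟩ := geometric_hahn_banach_open_point hAconv hAopen hα'
  -- The sign is reversed because `f` is smaller on `A` than at the point, while `A` is closed under
  -- increasing coordinates.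
  let g : Fin n → ℝ := fun i => -f (Pi.single i 1)
  have hfg : ∀ w, f w = -∑ i, g i * w i := by
    intro w
    conv_lhs => rw [pi_eq_sum_univ' w, map_sum]
    rw [← Finset.sum_neg_distrib]
    refine Finset.sum_congr rfl fun i _ => ?_
    rw [map_smul, smul_eq_mul]
    simp only [g]
    ring
  have hgA : ∀ w ∈ A, (∑ i, g i) * α < ∑ i, g i * w i := by
    intro w hw
    have := hf w hw
    rw [hfg, hfg, ← Finset.sum_mul] at this
    linarith
  obtain ⟨x₀, hx₀⟩ := hXne
  have hw₀ : (fun i => h i ⟨x₀, hx₀⟩ + 1) ∈ A := ⟨⟨x₀, hx₀⟩, fun i => by simp⟩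
  have hg0 : ∀ i, 0 ≤ g i := by
    intro i
    by_contra! hi
    -- Raising coordinate `i` by `D / (-g i)` stays in `A` but uses up the whole separation gap `D`.
    let D := ∑ j, g j * (h j ⟨x₀, hx₀⟩ + 1) - (∑ j, g j) * α
    have hD : 0 < D := by simpa [D] using hgA _ hw₀
    have hs : 0 ≤ D / (-g i) := by apply div_nonneg hD.le; linarith
    have hmem : (fun j => h j ⟨x₀, hx₀⟩ + 1 + Pi.single (M := fun _ => ℝ) i (D / (-g i)) j) ∈ A := by
      refine ⟨⟨x₀, hx₀⟩, fun j => ?_⟩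
      have : 0 ≤ Pi.single (M := fun _ => ℝ) i (D / (-g i)) j := by
        rw [Pi.single_apply]; split_ifs <;> simp [hs]
      linarith
    have h1 := hgA _ hmem
    rw [Finset.sum_congr rfl fun j _ => mul_add (g j) (h j ⟨x₀, hx₀⟩ + 1) _,
      Finset.sum_add_distrib] at h1
    simp only [Pi.single_apply, mul_ite, mul_zero, Finset.sum_ite_eq', Finset.mem_univ,
      if_true] at h1
    have h2 : g i * (D / (-g i)) = -D := by
      rw [div_neg, mul_neg, mul_div_cancel₀ _ hi.ne]
    rw [h2] at h1
    simp only [D] at h1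
    linarith
  have hsum : 0 < ∑ i, g i := by
    refine (Finset.sum_nonneg fun i _ => hg0 i).lt_of_ne fun h0 => ?_
    have hz := (Finset.sum_eq_zero_iff_of_nonneg fun i _ => hg0 i).1 h0.symm
    have := hgA _ hw₀
    rw [← h0, Finset.sum_eq_zero fun i hi => by rw [hz i hi, zero_mul]] at this
    simp at this
  obtain ⟨x, hx⟩ := hα (fun i => g i / ∑ j, g j)
    ⟨fun i => div_nonneg (hg0 i) hsum.le, by rw [← Finset.sum_div, div_self hsum.ne']⟩
  have h1 : ∑ i, g i * h i x < (∑ i, g i) * α := by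
    simp only [div_mul_eq_mul_div, ← Finset.sum_div] at hx
    rw [div_lt_iff₀ hsum] at hx
    linarith
  -- This shift puts a point of `A` exactly on the separating hyperplane.
  set δ := ((∑ i, g i) * α - ∑ i, g i * h i x) / (∑ i, g i) with hδ
  have hδ0 : 0 < δ := div_pos (by linarith) hsum
  have h2 := hgA (fun i => h i x + δ) ⟨x, fun i => by simpa using hδ0⟩
  simp only [mul_add, Finset.sum_add_distrib, ← Finset.sum_mul] at h2
  rw [hδ, mul_div_cancel₀ _ hsum.ne'] at h2
  linarith

/-- Subsets of separable metric spaces are separable, so the dense sequence can be taken among the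
sections themselves; sup-norm distance makes the approximation uniform in `x`. -/
theorem exists_dense_sections {X Y : Type*} [Nonempty Y] (H : X → Y → ℝ)
    (hHbdd : ∃ M : ℝ, ∀ x y, |H x y| ≤ M)
    (hHsep : TopologicalSpace.SeparableSpace (closedSpanSections H)) :
    ∃ u : ℕ → Y, ∀ y, ∀ ε > 0, ∃ i, ∀ x, |H x y - H x (u i)| < ε := by
  obtain ⟨M, hM⟩ := hHbdd
  let g : Y → lp (fun _ : X => ℝ) ∞ := fun y => ⟨fun x => H x y, memℓp_infty
    ⟨M, by rintro _ ⟨x, rfl⟩; exact hM x y⟩⟩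
  have hsub : Set.range g ⊆ (closedSpanSections H : Set (lp (fun _ : X => ℝ) ∞)) := by
    rintro _ ⟨y, rfl⟩
    exact Submodule.le_topologicalClosure _ (Submodule.subset_span ⟨y, fun _ => rfl⟩)
  have hsep : TopologicalSpace.IsSeparable (Set.range g) :=
    (TopologicalSpace.IsSeparable.of_subtype
      (closedSpanSections H : Set (lp (fun _ : X => ℝ) ∞))).mono hsub
  have := hsep.separableSpace
  have hch : ∀ p : Set.range g, ∃ y, g y = p := fun p => p.2
  choose r hr using hch
  refine ⟨fun i => r (TopologicalSpace.denseSeq (Set.range g) i), fun y ε hε => ?_⟩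
  obtain ⟨i, hi⟩ := (TopologicalSpace.denseRange_denseSeq (Set.range g)).exists_dist_lt
    ⟨g y, y, rfl⟩ hε
  refine ⟨i, fun x => ?_⟩
  rw [Subtype.dist_eq, ← hr (TopologicalSpace.denseSeq _ i), dist_eq_norm] at hi
  exact (lp.norm_apply_le_norm (by simp) (g y - g (r _)) x).trans_lt hi

/-! ### Simons' inequality. -/

section Simons

variable {E : Type*} [AddCommGroup E] [Module ℝ E] {X : Set E} {Y : Type*} {H : X → Y → ℝ}

/-- A bounded convex function is at most `α` on the dyadic averages of a sequence on which it is
at most `α`. -/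
theorem le_of_dyadic_tails {h : X → ℝ} {M α : ℝ} (hM : ∀ x, |h x| ≤ M)
    (hconv : ∀ (x₁ x₂ x₃ : X) (a b : ℝ), 0 ≤ a → 0 ≤ b → a + b = 1 →
      (x₃ : E) = a • (x₁ : E) + b • (x₂ : E) → h x₃ ≤ a * h x₁ + b * h x₂)
    {z t : ℕ → X}
    (ht : ∀ k, (t k : E) = (1 / 2 : ℝ) • (z k : E) + (1 / 2 : ℝ) • (t (k + 1) : E))
    {k : ℕ} (hz : ∀ j, k ≤ j → h (z j) ≤ α) : h (t k) ≤ α := by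
  -- No continuity of `h` is available, so the recursion is iterated instead; boundedness kills the
  -- remainder.
  have key : ∀ N, h (t k) - α ≤ (1 / 2 : ℝ) ^ N * (h (t (k + N)) - α) := by
    intro N
    induction N with
    | zero => simp
    | succ N ih =>
      have h1 := hconv _ _ _ (1 / 2) (1 / 2) (by norm_num) (by norm_num) (by norm_num)
        (ht (k + N))
      have h2 := hz (k + N) (by omega)
      have h3 : h (t (k + N)) - α ≤ 1 / 2 * (h (t (k + (N + 1))) - α) := by
        rw [← add_assoc]; linarith
      calc _ ≤ _ := ih
        _ ≤ (1 / 2 : ℝ) ^ N * (1 / 2 * (h (t (k + (N + 1))) - α)) := by gcongr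
        _ = _ := by ring
  have hle : ∀ N, h (t k) - α ≤ (1 / 2 : ℝ) ^ N * (M - α) := fun N =>
    (key N).trans (by gcongr; exact (abs_le.1 (hM _)).2)
  have hlim : Tendsto (fun N : ℕ => (1 / 2 : ℝ) ^ N * (M - α)) atTop (𝓝 (0 * (M - α))) :=
    (tendsto_pow_atTop_nhds_zero_of_lt_one (by norm_num) (by norm_num)).mul_const _
  have := ge_of_tendsto' hlim hle
  linarith

/-- One step of Simons' construction: from the average `a` of total mass `2 ^ k - 1`, pick `z` in
`C` almost minimizing `S ((1 - 2⁻ᵏ) a + 2⁻ᵏ z)`, and let `a'` be the next average. -/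
theorem exists_simons_step {S : X → ℝ} {M δ : ℝ} (hδ : 0 < δ) (hM : ∀ x, |S x| ≤ M)
    (hXc : ∀ (x₁ x₂ : X) (a b : ℝ), 0 ≤ a → 0 ≤ b → a + b = 1 →
      ∃ x₃ : X, (x₃ : E) = a • (x₁ : E) + b • (x₂ : E))
    (hconv : ∀ (y : Y) (x₁ x₂ x₃ : X) (a b : ℝ), 0 ≤ a → 0 ≤ b → a + b = 1 →
      (x₃ : E) = a • (x₁ : E) + b • (x₂ : E) → H x₃ y ≤ a * H x₁ y + b * H x₂ y)
    (hS : ∀ x y, H x y ≤ S x) {C : Set X} (hC : C.Nonempty) (k : ℕ) (a : X) :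
    ∃ z ∈ C, ∃ a' : X, ((2 : ℝ) ^ (k + 1) - 1) • (a' : E)
        = (2 * ((2 : ℝ) ^ k - 1)) • (a : E) + (z : E) ∧
      ∀ y, ∀ z' ∈ C, ∀ b' : X,
        (2 : ℝ) ^ k • (b' : E) = ((2 : ℝ) ^ k - 1) • (a : E) + (z' : E) →
        ((2 : ℝ) ^ (k + 1) - 1) * H a' y ≤
          ((2 : ℝ) ^ k - 1) * H a y + 2 ^ k * S b' + δ * ((1 / 2) ^ k - (1 / 2) ^ (k + 1)) := by
  have hp : (1 : ℝ) ≤ 2 ^ k := one_le_pow₀ (by norm_num)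
  set p : ℝ := 2 ^ k with hpdef
  have hp0 : 0 < p := by linarith
  have hp1 : 0 < 2 * p - 1 := by linarith
  have hcomb : ∀ z : X, ∃ b : X, p • (b : E) = (p - 1) • (a : E) + (z : E) := by
    intro z
    obtain ⟨b, hb⟩ := hXc a z ((p - 1) / p) (1 / p) (div_nonneg (by linarith) hp0.le)
      (by positivity) (by field_simp; ring)
    refine ⟨b, ?_⟩
    rw [hb, smul_add, smul_smul, smul_smul, mul_div_cancel₀ _ hp0.ne', mul_div_cancel₀ _ hp0.ne',
      one_smul]
  choose b hb using hcomb
  have hbdd : BddBelow ((fun z => S (b z)) '' C) :=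
    ⟨-M, by rintro _ ⟨z, -, rfl⟩; exact (abs_le.1 (hM _)).1⟩
  -- The tolerances telescope to less than `δ` over all steps; dividing by `p` offsets the factor `2
  -- ^ k` on `S b'`.
  have hgap : 0 < δ * ((1 / 2) ^ k - (1 / 2) ^ (k + 1)) / p := by
    rw [pow_succ]
    have : (0 : ℝ) < (1 / 2) ^ k := by positivity
    exact div_pos (mul_pos hδ (by linarith)) hp0
  obtain ⟨_, ⟨z, hz, rfl⟩, hlt⟩ := Real.lt_sInf_add_pos (hC.image fun z => S (b z)) hgap
  obtain ⟨a', ha'⟩ := hXc a (b z) ((p - 1) / (2 * p - 1)) (p / (2 * p - 1))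
    (div_nonneg (by linarith) hp1.le) (by positivity)
    (by rw [← add_div, show p - 1 + p = 2 * p - 1 by ring, div_self hp1.ne'])
  refine ⟨z, hz, a', ?_, ?_⟩
  · rw [pow_succ', ← hpdef, ha', smul_add, smul_smul, smul_smul, mul_div_cancel₀ _ hp1.ne',
      mul_div_cancel₀ _ hp1.ne', hb, ← add_assoc, ← add_smul]
    ring_nf
  · intro y z' hz' b' hb'
    have hbb : b' = b z' := by
      apply Subtype.ext
      exact smul_right_injective E hp0.ne' (hb'.trans (hb z').symm)
    have h1 : S (b z) < S b' + δ * ((1 / 2) ^ k - (1 / 2) ^ (k + 1)) / p := by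
      rw [hbb]
      exact hlt.trans_le (add_le_add_left (csInf_le hbdd ⟨z', hz', rfl⟩) _)
    have h2 := hconv y _ _ _ _ _ (div_nonneg (by linarith) hp1.le) (by positivity)
      (by rw [← add_div, show p - 1 + p = 2 * p - 1 by ring, div_self hp1.ne']) ha'
    have h3 : (2 * p - 1) * H a' y ≤ (p - 1) * H a y + p * H (b z) y := by
      calc _ ≤ (2 * p - 1) * ((p - 1) / (2 * p - 1) * H a y + p / (2 * p - 1) * H (b z) y) := by
            gcongr
        _ = _ := by rw [mul_add, ← mul_assoc, ← mul_assoc, mul_div_cancel₀ _ hp1.ne',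
            mul_div_cancel₀ _ hp1.ne']
    have h4 : p * H (b z) y ≤ p * S b' + δ * ((1 / 2) ^ k - (1 / 2) ^ (k + 1)) := by
      calc _ ≤ p * (S b' + δ * ((1 / 2) ^ k - (1 / 2) ^ (k + 1)) / p) := by
            gcongr; exact (hS _ _).trans h1.le
        _ = _ := by field_simp
    rw [pow_succ' 2 k, ← hpdef]
    linarith

/-- A form of Simons' inequality: if for each finite initial segment of `u` some point of `X`
makes all the corresponding sections at most `α`, then `inf sup H ≤ α`, up to any `δ > 0`. -/
theorem exists_forall_le_add_of_dense_sections [TopologicalSpace E] [IsTopologicalAddGroup E]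
    [ContinuousSMul ℝ E] [T2Space E]
    (hXne : X.Nonempty) (hX : InvariantUnderInfiniteConvexCombinations X) {M : ℝ}
    (hM : ∀ x y, |H x y| ≤ M)
    (hconv : ∀ (y : Y) (x₁ x₂ x₃ : X) (a b : ℝ), 0 ≤ a → 0 ≤ b → a + b = 1 →
      (x₃ : E) = a • (x₁ : E) + b • (x₂ : E) → H x₃ y ≤ a * H x₁ y + b * H x₂ y)
    (hatt : ∀ x : X, ∃ y₀ : Y, ∀ y : Y, H x y ≤ H x y₀)
    {u : ℕ → Y} (hu : ∀ y, ∀ ε > 0, ∃ i, ∀ x, |H x y - H x (u i)| < ε) {α : ℝ}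
    (hα : ∀ k : ℕ, ∃ x, ∀ i < k, H x (u i) ≤ α) {δ : ℝ} (hδ : 0 < δ) :
    ∃ v, ∀ y, H v y ≤ α + 2 * δ := by
  choose m hm using hatt
  have hXc := hX.exists_combo
  have hstep := fun (k : ℕ) (a : X) => exists_simons_step (S := fun x => H x (m x)) hδ
    (fun x => hM x (m x)) hXc hconv hm (C := {x | ∀ i < k, H x (u i) ≤ α}) (hα k) k a
  choose Z hZ N hN hNle using hstep
  obtain ⟨x₀, hx₀⟩ := hXne
  -- The starting point is immaterial: its weight is `2 ^ 0 - 1 = 0`.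
  let a : ℕ → X := fun k => Nat.rec (motive := fun _ => X) ⟨x₀, hx₀⟩ (fun k x => N k x) k
  have ha : ∀ k, a (k + 1) = N k (a k) := fun k => rfl
  obtain ⟨t, ht⟩ := hX.exists_dyadic_tails (fun k => (Z k (a k) : X))
  have htC : ∀ k, ∀ i < k, H (t k) (u i) ≤ α := fun k i hik =>
    le_of_dyadic_tails (h := fun x => H x (u i)) (fun x => hM x _) (hconv (u i)) ht
      fun j hj => hZ j (a j) i (by omega)
  have hv : ∀ k, (2 : ℝ) ^ k • (t 0 : E) = ((2 : ℝ) ^ k - 1) • (a k : E) + (t k : E) := by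
    intro k
    induction k with
    | zero => simp
    | succ k ih =>
      rw [ha, hN, pow_succ', mul_smul, ih, smul_add, ht k, smul_add, smul_smul, smul_smul,
        smul_smul]
      norm_num
      abel
  refine ⟨t 0, fun y => (hm _ y).trans ?_⟩
  set y₀ := m (t 0)
  have hbound : ∀ k, ((2 : ℝ) ^ k - 1) * H (a k) y₀ ≤
      (2 ^ k - 1) * H (t 0) y₀ + δ * (1 - (1 / 2) ^ k) := by
    intro k
    induction k with
    | zero => simp
    | succ k ih =>
      -- The tail `t k` is an admissible choice in the greedy step, and the competing average it
      -- produces is `t 0`.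
      have := hNle k (a k) y₀ (t k) (htC k) (t 0) (hv k)
      rw [ha]
      have h2 : (2 : ℝ) ^ (k + 1) = 2 * 2 ^ k := pow_succ' _ _
      rw [h2] at this ⊢
      change _ ≤ _ + _ * H (t 0) y₀ + _ at this
      linarith
  -- Stage `i + 1` is the first whose constraints include `u i`.
  obtain ⟨i, hi⟩ := hu y₀ δ hδ
  have hp : (1 : ℝ) ≤ 2 ^ (i + 1) := one_le_pow₀ (by norm_num)
  have h1 := hbound (i + 1)
  have h2 := hv (i + 1)
  have h5 : 0 ≤ δ * (1 / 2) ^ (i + 1) := by positivity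
  generalize (2 : ℝ) ^ (i + 1) = p at hp h1 h2
  have hp0 : 0 < p := by linarith
  have h3 := hconv y₀ (a (i + 1)) (t (i + 1)) (t 0) ((p - 1) / p) (1 / p)
    (div_nonneg (by linarith) hp0.le) (by positivity) (by field_simp; ring) (by
      apply smul_right_injective E hp0.ne'
      simp only [smul_add, smul_smul]
      rw [mul_div_cancel₀ _ hp0.ne', mul_div_cancel₀ _ hp0.ne', one_smul, h2])
  have h4 : p * H (t 0) y₀ ≤ (p - 1) * H (a (i + 1)) y₀ + H (t (i + 1)) y₀ := by
    calc _ ≤ p * ((p - 1) / p * H (a (i + 1)) y₀ + 1 / p * H (t (i + 1)) y₀) := by gcongr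
      _ = _ := by field_simp
  have h6 := htC (i + 1) i (by omega)
  have h7 := (abs_lt.1 (hi (t (i + 1)))).2
  linarith

end Simons

theorem corollary4p8 {E : Type*} [AddCommGroup E] [Module ℝ E] [TopologicalSpace E]
    [IsTopologicalAddGroup E] [ContinuousSMul ℝ E] [T2Space E]
    {Y : Type*} [Nonempty Y]
    (X : Set E) (hXne : X.Nonempty) (hX : InvariantUnderInfiniteConvexCombinations X)
    (H L : X → Y → ℝ)
    (hHbdd : ∃ M : ℝ, ∀ (x : X) (y : Y), |H x y| ≤ M)
    (hHconv : ∀ (y : Y) (x₁ x₂ x₃ : X) (a b : ℝ), 0 ≤ a → 0 ≤ b → a + b = 1 →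
      (x₃ : E) = a • (x₁ : E) + b • (x₂ : E) → H x₃ y ≤ a * H x₁ y + b * H x₂ y)
    (hHhom : ∀ (y : Y) (x x' : X) (c : ℝ), 0 < c → (x' : E) = c • (x : E) →
      H x' y = c * H x y)
    (hHatt : ∀ x : X, ∃ y₀ : Y, ∀ y : Y, H x y ≤ H x y₀)
    (hHsep : TopologicalSpace.SeparableSpace (closedSpanSections H))
    (hL : SupinfConcave L)
    (hHL : ∀ (x : X) (y : Y), H x y ≤ L x y) :
    (⨅ x : X, ⨆ y : Y, ((H x y : ℝ) : EReal)) ≤ ⨆ y : Y, ⨅ x : X, ((L x y : ℝ) : EReal) := by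
  by_contra! hlt
  obtain ⟨α, hα, hαH⟩ := EReal.lt_iff_exists_real_btwn.1 hlt
  obtain ⟨β, hαβ, hβH⟩ := EReal.lt_iff_exists_real_btwn.1 hαH
  have hαβ' : α < β := EReal.coe_lt_coe_iff.1 hαβ
  obtain ⟨u, hu⟩ := exists_dense_sections H hHbdd hHsep
  have hfin : ∀ k : ℕ, ∃ x, ∀ i < k, H x (u i) ≤ α := by
    intro k
    rcases Nat.eq_zero_or_pos k with rfl | hk
    · obtain ⟨x, hx⟩ := hXne
      exact ⟨⟨x, hx⟩, by simp⟩
    obtain ⟨x, hx⟩ := exists_forall_lt_of_forall_stdSimplex hXne hX.exists_combo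
      (fun (i : Fin k) x => H x (u i)) (fun i => hHconv (u i)) α (by
        intro l hl
        rw [hL] at hα
        have h1 : (⨅ x : X, ((∑ i, l i * L x (u i) : ℝ) : EReal)) < α := by
          refine lt_of_le_of_lt ?_ hα
          exact le_iSup_of_le k <| le_iSup_of_le hk <| le_iSup_of_le (fun i : Fin k => u i) <|
            le_iSup_of_le l <| le_iSup_of_le hl le_rfl
        obtain ⟨x, hx⟩ := iInf_lt_iff.1 h1
        refine ⟨x, lt_of_le_of_lt ?_ (EReal.coe_lt_coe_iff.1 hx)⟩
        exact Finset.sum_le_sum fun i _ => mul_le_mul_of_nonneg_left (hHL x (u i)) (hl.1 i))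
    exact ⟨x, fun i hi => (hx ⟨i, hi⟩).le⟩
  obtain ⟨M, hM⟩ := hHbdd
  -- With `δ = (β - α) / 2` the bound `α + 2δ` is exactly `β`.
  obtain ⟨v, hv⟩ := exists_forall_le_add_of_dense_sections hXne hX hM hHconv hHatt hu hfin
    (half_pos (sub_pos.2 hαβ'))
  refine absurd hβH (not_lt.2 ((iInf_le _ v).trans (iSup_le fun y => ?_)))
  have := hv y
  exact EReal.coe_le_coe_iff.2 (by linarith)
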